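/- Let $I\subseteq\mathbb{R}$ be an interval (for instance $I=\mathbb{R}$, or a bounded interval). A \emph{cloud} $[\delta,\pi]$ on $I$ is a pair of maps $\delta,\pi:I\to[0,1]$ with $\delta\le\pi$, $\pi(r)=1$ for at least one $r$ and $\delta(r')=0$ for at least one $r'$. It is \emph{comonotonic} if $\delta(x)<\delta(y)$ implies $\pi(x)\le\pi(y)$ for all $x,y\in I$. Its credal set $\mathcal{P}_{[\delta,\pi]}$ is the set of all ($\sigma$-additive) Borel probability measures $P$ on $I$ such that $$P(\{r:\delta(r)\ge\alpha\})\le 1-\alpha\le P(\{r:\pi(r)>\alpha\})\qquad\text{for all }\alpha\in[0,1].$$ A family $(E_\alpha)_{\alpha\in[0,1]}$ of subsets of $I$ is called a \emph{continuous random set with uniform mass density} if $\{\alpha\in[0,1]:E_\alpha\subseteq A\}$ is Lebesgue measurable for every Borel set $A\subseteq I$ and the empty set has mass zero, i.e. $\{\alpha\in[0,1]:E_\alpha=\emptyset\}$ has Lebesgue measure zero. Its belief function is $Bel(A)=\lambda(\{\alpha\in[0,1]:E_\alpha\subseteq A\})$, where $\lambda$ is Lebesgue measure, and its credal set is the set of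 all Borel probability measures $P$ on $I$ with $Bel(A)\le P(A)$ for every Borel set $A\subseteq I$. Let $[\delta,\pi]$ be a comonotonic cloud on $I$ with $\delta$ and $\pi$ continuous. (a) Let $E_\alpha=\{r\in I:\pi(r)\ge\alpha,\ \delta(r)<\alpha\}$ for $\alpha\in[0,1]$, and suppose that $E_\alpha\neq\emptyset$ for Lebesgue-almost every $\alpha\in[0,1]$. Then $(E_\alpha)_{\alpha\in[0,1]}$ is a continuous random set with uniform mass density, and its credal set is $\mathcal{P}_{[\delta,\pi]}$. (b) Without that supposition (thus also for thin clouds, $\delta=\pi$), the closed sets $\overline{E}_\alpha=\{r\in I:\pi(r)\ge\alpha,\ \delta(r)\le\alpha\}$, $\alpha\in[0,1]$, form a continuous random set with uniform mass density, and its credal set is $\mathcal{P}_{[\delta,\pi]}$. -/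

import Mathlib

open MeasureTheory Set

noncomputable section

namespace Clouds

/-- A cloud `[δ, π]` on `X`: two maps into the unit interval with `δ ≤ π`, where `π` takes the
value `1` and `δ` takes the value `0`. -/
structure IsCloud {X : Type*} (δ π : X → ℝ) : Prop where
  lower_nonneg : ∀ x, 0 ≤ δ x
  lower_le_upper : ∀ x, δ x ≤ π x
  upper_le_one : ∀ x, π x ≤ 1
  exists_upper_eq_one : ∃ x, π x = 1
  exists_lower_eq_zero : ∃ y, δ y = 0

/-- The two distributions of the cloud are comonotonic. -/
def IsComonotonic {X : Type*} (δ π : X → ℝ) : Prop :=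
  ∀ x y, δ x < δ y → π x ≤ π y

/-- The credal set of a cloud: the (σ-additive) probability measures `P` with
`P (δ ≥ α) ≤ 1 - α ≤ P (π > α)` for all levels `α ∈ [0, 1]`. -/
def cloudCredalSet {X : Type*} [MeasurableSpace X] (δ π : X → ℝ) : Set (ProbabilityMeasure X) :=
  {P | ∀ α ∈ Icc (0 : ℝ) 1,
    (P : Measure X) {x | α ≤ δ x} ≤ ENNReal.ofReal (1 - α) ∧
    ENNReal.ofReal (1 - α) ≤ (P : Measure X) {x | α < π x}}

/-- The multimapping `α ↦ E α`, with Lebesgue measure on `[0, 1]` as mass density, is a random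
set: the events `E α ⊆ A` are Lebesgue measurable, and the empty set carries no mass. -/
structure IsRandomSet {X : Type*} [MeasurableSpace X] (E : ℝ → Set X) : Prop where
  nullMeasurableSet_subset : ∀ A : Set X, MeasurableSet A →
    NullMeasurableSet {α | α ∈ Icc (0 : ℝ) 1 ∧ E α ⊆ A} volume
  mass_empty : volume {α | α ∈ Icc (0 : ℝ) 1 ∧ E α = ∅} = 0

/-- The belief function of the random set with uniform mass density on `[0, 1]`:
`Bel A` is the mass of the focal sets contained in `A`. -/
def belief {X : Type*} (E : ℝ → Set X) (A : Set X) : ENNReal :=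
  volume {α | α ∈ Icc (0 : ℝ) 1 ∧ E α ⊆ A}

/-- The credal set of the random set: the probability measures that dominate its belief
function. -/
def beliefCredalSet {X : Type*} [MeasurableSpace X] (E : ℝ → Set X) :
    Set (ProbabilityMeasure X) :=
  {P | ∀ A : Set X, MeasurableSet A → belief E A ≤ (P : Measure X) A}

/-- The focal sets `E_α = {π ≥ α, δ < α}`. -/
def focalSet {X : Type*} (δ π : X → ℝ) (α : ℝ) : Set X :=
  {x | α ≤ π x ∧ δ x < α}

/-- The closed focal sets `{π ≥ α, δ ≤ α}`; for a thin cloud these are the sets `{π = α}`. -/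
def closedFocalSet {X : Type*} (δ π : X → ℝ) (α : ℝ) : Set X :=
  {x | α ≤ π x ∧ δ x ≤ α}

end Clouds

end

namespace Clouds

open Filter Topology ProbabilityTheory

/-! The belief inequalities for `{δ < α}` and `{π > α}` give back the cloud constraints. Conversely,
comonotonicity makes `δ` and `π` increasing functions of `g = δ + π`. If `q` is the quantile
function of the law of `g` under `P` and `q u = g x`, the cloud constraints force `δ x ≤ u ≤ π x`,
so `x` lies in the closed focal set at level `u`. As `q` pushes uniform measure to that law, the
levels whose closed focal set meets `B` have mass at least `P B`; `B = Aᶜ` gives the belief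
inequality for `A`. These level sets are projections of Borel sets, hence measurable only through
capacitability. For (a), both kinds of focal set give the same belief function, up to a null set of
levels. -/

/-! ### Analytic sets are universally measurable -/

/-- An open set containing the compact box `{x | ∀ i, x i ≤ N i}` of the Baire space contains a
cylinder which only restricts finitely many coordinates. -/
theorem exists_cylinder_subset_of_box_subset {U : Set (ℕ → ℕ)} (hU : IsOpen U) {N : ℕ → ℕ}
    (h : {x : ℕ → ℕ | ∀ i, x i ≤ N i} ⊆ U) :
    ∃ n, {x : ℕ → ℕ | ∀ i < n, x i ≤ N i} ⊆ U := by
  by_contra! hcon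
  simp only [Set.not_subset] at hcon
  choose x hx hxU using hcon
  have hK : IsCompact {x : ℕ → ℕ | ∀ i, x i ≤ N i} := by
    have := isCompact_univ_pi (fun i => (Set.finite_Iic (N i)).isCompact)
    convert this using 1
    ext x
    simp [Pi.le_def]
  -- Truncation moves the points into the compact box; it leaves the first `n` coordinates of `x n`
  -- unchanged, so the limit is not affected.
  obtain ⟨y, hy, φ, hφ, hlim⟩ := hK.tendsto_subseq (x := fun n i => min (x n i) (N i))
    (fun n i => min_le_right _ _)
  have hlim' : Tendsto (x ∘ φ) atTop (𝓝 y) := by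
    rw [tendsto_pi_nhds] at hlim ⊢
    intro i
    refine (hlim i).congr' ?_
    filter_upwards [eventually_gt_atTop i] with n hn
    exact min_eq_left (hx _ i (hn.trans_le (hφ.id_le n)))
  obtain ⟨n, hn⟩ := (hlim'.eventually (hU.mem_nhds (h hy))).exists
  exact hxU _ hn

/-- Analytic sets are inner regular for compact sets: the capacitability theorem for outer regular
measures. -/
theorem exists_isCompact_subset_le_measure_of_analyticSet {α : Type*} [TopologicalSpace α]
    [MeasurableSpace α] {μ : Measure α} [μ.OuterRegular] {s : Set α} (hs : AnalyticSet s)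
    {r : ENNReal} (hr : r < μ s) : ∃ K ⊆ s, IsCompact K ∧ r ≤ μ K := by
  rw [AnalyticSet] at hs
  rcases hs with rfl | ⟨f, hf, rfl⟩
  · simp at hr
  have step : ∀ (A : Set (ℕ → ℕ)) (n : ℕ), ∃ k : ℕ,
      r < μ (f '' A) → r < μ (f '' (A ∩ {x | x n ≤ k})) := by
    intro A n
    by_cases hA : r < μ (f '' A)
    · have hU : f '' A = ⋃ k : ℕ, f '' (A ∩ {x | x n ≤ k}) := by
        rw [← image_iUnion, ← inter_iUnion]
        congr 1
        refine (inter_eq_left.2 fun x _ => mem_iUnion.2 ⟨x n, ?_⟩).symm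
        exact le_refl (x n)
      have hmono : Monotone fun k : ℕ => f '' (A ∩ {x | x n ≤ k}) := by
        intro k l hkl
        exact image_mono (inter_subset_inter_right _ fun x (hx : x n ≤ k) => hx.trans hkl)
      -- Continuity from below along increasing unions needs no measurability of the images.
      rw [hU, hmono.measure_iUnion, lt_iSup_iff] at hA
      obtain ⟨k, hk⟩ := hA
      exact ⟨k, fun _ => hk⟩
    · exact ⟨0, fun h => absurd h hA⟩
  choose k hk using step
  let A : ℕ → Set (ℕ → ℕ) := fun n => Nat.rec univ (fun n B => B ∩ {x | x n ≤ k B n}) n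
  have hA : ∀ n, r < μ (f '' A n) := by
    intro n
    induction n with
    | zero => simpa [A] using hr
    | succ n ih => exact hk _ _ ih
  have hAeq : ∀ n, A n = {x | ∀ i < n, x i ≤ k (A i) i} := by
    intro n
    induction n with
    | zero => simp [A]
    | succ n ih =>
      change A n ∩ {x | x n ≤ k (A n) n} = _
      ext x
      have hx : x ∈ A n ↔ ∀ i < n, x i ≤ k (A i) i := by
        nth_rw 1 [ih]
        rfl
      rw [mem_inter_iff, hx]
      simp only [mem_ofPred_eq, Nat.lt_succ_iff_lt_or_eq]
      constructor
      · rintro ⟨h1, h2⟩ i (hi | rfl)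
        exacts [h1 i hi, h2]
      · exact fun h => ⟨fun i hi => h i (Or.inl hi), h n (Or.inr rfl)⟩
  have hK : IsCompact {x : ℕ → ℕ | ∀ i, x i ≤ k (A i) i} := by
    have := isCompact_univ_pi (fun i => (Set.finite_Iic (k (A i) i)).isCompact)
    convert this using 1
    ext x
    simp [Pi.le_def]
  refine ⟨f '' {x | ∀ i, x i ≤ k (A i) i}, image_subset_range _ _, hK.image hf, ?_⟩
  refine le_of_forall_gt fun c hc => ?_
  obtain ⟨O, hKO, hO, hOc⟩ := Set.exists_isOpen_lt_of_lt _ c hc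
  obtain ⟨n, hn⟩ := exists_cylinder_subset_of_box_subset (hO.preimage hf) (image_subset_iff.1 hKO)
  rw [← hAeq] at hn
  exact ((hA n).trans_le (measure_mono (image_subset_iff.2 hn))).trans hOc

/-- Analytic sets are universally measurable. -/
theorem nullMeasurableSet_of_analyticSet {α : Type*} [TopologicalSpace α] [T2Space α]
    [MeasurableSpace α] [OpensMeasurableSpace α] {μ : Measure α} [IsFiniteMeasure μ]
    [μ.OuterRegular] {s : Set α} (hs : AnalyticSet s) : NullMeasurableSet s μ := by
  have key : ∀ n : ℕ, ∃ K ⊆ s, MeasurableSet K ∧ μ s ≤ μ K + (n + 1 : ENNReal)⁻¹ := by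
    intro n
    rcases eq_or_ne (μ s) 0 with h0 | h0
    · exact ⟨∅, empty_subset _, MeasurableSet.empty, by simp [h0]⟩
    · have hlt : μ s - (n + 1 : ENNReal)⁻¹ < μ s :=
        ENNReal.sub_lt_self (measure_ne_top _ _) h0 (by simp)
      obtain ⟨K, hKs, hK, hle⟩ := exists_isCompact_subset_le_measure_of_analyticSet hs hlt
      exact ⟨K, hKs, hK.measurableSet, tsub_le_iff_right.1 hle⟩
  choose K hKs hKm hK using key
  have hM : MeasurableSet (⋃ n, K n) := MeasurableSet.iUnion hKm
  have hMs : (⋃ n, K n) ⊆ s := iUnion_subset hKs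
  have hle : μ s ≤ μ (⋃ n, K n) := by
    refine ge_of_tendsto' (f := fun n : ℕ => μ (⋃ n, K n) + (n + 1 : ENNReal)⁻¹)
      (x := atTop) ?_ fun n => (hK n).trans (by gcongr; exact subset_iUnion K n)
    have h := (tendsto_add_atTop_iff_nat 1).2 ENNReal.tendsto_inv_nat_nhds_zero
    simpa using h.const_add (μ (⋃ n, K n))
  have hae : (⋃ n, K n) =ᵐ[μ] toMeasurable μ s :=
    ae_eq_of_subset_of_measure_ge (hMs.trans (subset_toMeasurable μ s))
      (by rwa [measure_toMeasurable]) hM.nullMeasurableSet (measure_ne_top _ _)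
  have hs' : (⋃ n, K n) =ᵐ[μ] s :=
    (LE.le.eventuallyLE hMs).antisymm
      ((LE.le.eventuallyLE (subset_toMeasurable μ s)).trans hae.symm.le)
  exact hM.nullMeasurableSet.congr hs'

/-! ### Quantile functions -/

/-- The quantile function of a probability measure on the line: a generalized inverse of the
distribution function which pushes the uniform distribution to the given measure. -/
theorem exists_quantile (Q : Measure ℝ) [IsProbabilityMeasure Q] :
    ∃ q : ℝ → ℝ, AEMeasurable q (volume.restrict (Ioo 0 1)) ∧
      (volume.restrict (Ioo (0 : ℝ) 1)).map q = Q ∧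
      ∀ u ∈ Ioo (0 : ℝ) 1, ∀ t, q u ≤ t ↔ u ≤ cdf Q t := by
  let q : ℝ → ℝ := fun u => sInf {t | u ≤ cdf Q t}
  have hq : ∀ u ∈ Ioo (0 : ℝ) 1, ∀ t, q u ≤ t ↔ u ≤ cdf Q t := by
    rintro u ⟨hu0, hu1⟩ t
    have hne : {t | u ≤ cdf Q t}.Nonempty :=
      ((tendsto_cdf_atTop Q).eventually (eventually_ge_nhds hu1)).exists
    have hbdd : BddBelow {t | u ≤ cdf Q t} := by
      obtain ⟨b, hb⟩ := ((tendsto_cdf_atBot Q).eventually (eventually_lt_nhds hu0)).exists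
      exact ⟨b, fun t ht => le_of_not_gt fun hlt =>
        (lt_of_le_of_lt (ht.trans (monotone_cdf Q hlt.le)) hb).false⟩
    refine ⟨fun h => ?_, fun h => csInf_le hbdd h⟩
    have hright : Tendsto (cdf Q) (𝓝[>] t) (𝓝 (cdf Q t)) :=
      ((cdf Q).right_continuous t).mono_left (nhdsWithin_mono _ Ioi_subset_Ici_self)
    refine ge_of_tendsto hright ?_
    filter_upwards [self_mem_nhdsWithin] with v hv
    obtain ⟨w, hw, hwv⟩ := exists_lt_of_csInf_lt hne (lt_of_le_of_lt h hv)
    exact le_trans hw (monotone_cdf Q hwv.le)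
  have hmono : MonotoneOn q (Ioo 0 1) := fun u hu v hv huv =>
    (hq u hu _).2 (huv.trans ((hq v hv _).1 le_rfl))
  have hmeas : AEMeasurable q (volume.restrict (Ioo 0 1)) :=
    aemeasurable_restrict_of_monotoneOn measurableSet_Ioo hmono
  refine ⟨q, hmeas, ?_, hq⟩
  have : IsFiniteMeasure ((volume.restrict (Ioo (0 : ℝ) 1)).map q) := by
    infer_instance
  refine Measure.ext_of_Iic _ _ fun t => ?_
  rw [Measure.map_apply_of_aemeasurable hmeas measurableSet_Iic,
    Measure.restrict_apply' measurableSet_Ioo]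
  have hset : q ⁻¹' Iic t ∩ Ioo 0 1 = Ioo 0 1 ∩ Iic (cdf Q t) := by
    ext u
    simp only [mem_inter_iff, mem_preimage, mem_Iic]
    exact ⟨fun h => ⟨h.2, (hq u h.2 t).1 h.1⟩, fun h => ⟨(hq u h.1 t).2 h.2, h.1⟩⟩
  rw [hset, ← ofReal_cdf]
  refine le_antisymm ?_ ?_
  · calc volume (Ioo 0 1 ∩ Iic (cdf Q t)) ≤ volume (Icc 0 (cdf Q t)) :=
        measure_mono fun u hu => ⟨hu.1.1.le, hu.2⟩
      _ = ENNReal.ofReal (cdf Q t) := by simp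
  · calc ENNReal.ofReal (cdf Q t) = volume (Ioo 0 (cdf Q t)) := by simp
      _ ≤ volume (Ioo 0 1 ∩ Iic (cdf Q t)) :=
        measure_mono fun u hu => ⟨⟨hu.1, hu.2.trans_le (cdf_le_one Q t)⟩, hu.2.le⟩

/-! ### Comonotonic clouds and the mass of levels meeting a set -/

theorem IsCloud.upper_nonneg {X : Type*} {δ π : X → ℝ} (h : IsCloud δ π) (x : X) : 0 ≤ π x :=
  (h.lower_nonneg x).trans (h.lower_le_upper x)

theorem IsCloud.lower_le_one {X : Type*} {δ π : X → ℝ} (h : IsCloud δ π) (x : X) : δ x ≤ 1 :=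
  (h.lower_le_upper x).trans (h.upper_le_one x)

/-- Comonotonic functions are both increasing for the preorder induced by their sum. -/
theorem IsComonotonic.le_of_add_le_add {X : Type*} {δ π : X → ℝ} (h : IsComonotonic δ π) {x y : X}
    (hxy : δ x + π x ≤ δ y + π y) : δ x ≤ δ y ∧ π x ≤ π y := by
  refine ⟨?_, ?_⟩
  · by_contra! hlt
    have := h y x hlt
    linarith
  · by_contra! hlt
    have : δ x < δ y := by linarith
    exact absurd (h x y this) (not_le.2 hlt)

/-- The levels `α ∈ [0, 1]` of the closed focal sets that meet `B` have mass at least `P B`, for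
every probability measure in the credal set of a comonotonic cloud. -/
theorem measure_le_volume_closedFocalSet_inter_nonempty {X : Type*} [MeasurableSpace X]
    [StandardBorelSpace X] {δ π : X → ℝ} (hcloud : IsCloud δ π) (hcom : IsComonotonic δ π)
    (hδ : Measurable δ) (hπ : Measurable π) {P : ProbabilityMeasure X}
    (hP : P ∈ cloudCredalSet δ π) {B : Set X} (hB : MeasurableSet B) :
    (P : Measure X) B ≤
      volume {α | α ∈ Icc (0 : ℝ) 1 ∧ (closedFocalSet δ π α ∩ B).Nonempty} := by
  let g : X → ℝ := fun x => δ x + π x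
  have hg : Measurable g := hδ.add hπ
  let Q : Measure ℝ := (P : Measure X).map g
  have : IsProbabilityMeasure Q := Measure.isProbabilityMeasure_map hg.aemeasurable
  obtain ⟨q, hqm, hqQ, hq⟩ := exists_quantile Q
  have hgB : NullMeasurableSet (g '' B) Q := nullMeasurableSet_of_analyticSet
    (hB.analyticSet_image hg)
  have hupper : ∀ x, ∀ u ∈ Ioo (0 : ℝ) 1, q u = g x → u ≤ π x := by
    intro x u hu hux
    have h1 : u ≤ cdf Q (g x) := (hq u hu _).1 hux.le
    rw [← ENNReal.ofReal_le_ofReal_iff (hcloud.upper_nonneg x)]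
    calc ENNReal.ofReal u ≤ ENNReal.ofReal (cdf Q (g x)) := ENNReal.ofReal_le_ofReal h1
      _ = (P : Measure X) {y | g y ≤ g x} := by
        rw [ofReal_cdf, Measure.map_apply hg measurableSet_Iic]; rfl
      _ ≤ (P : Measure X) {y | π x < π y}ᶜ :=
        measure_mono fun y hy => not_lt.2 (hcom.le_of_add_le_add hy).2
      _ = 1 - (P : Measure X) {y | π x < π y} :=
        prob_compl_eq_one_sub (measurableSet_lt measurable_const hπ)
      _ ≤ 1 - ENNReal.ofReal (1 - π x) :=
        tsub_le_tsub_left (hP _ ⟨hcloud.upper_nonneg x, hcloud.upper_le_one x⟩).2 _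
      _ = ENNReal.ofReal (π x) := by
        rw [← ENNReal.ofReal_one, ← ENNReal.ofReal_sub _ (sub_nonneg.2 (hcloud.upper_le_one x)),
          sub_sub_cancel]
  have hlower : ∀ x, ∀ u ∈ Ioo (0 : ℝ) 1, q u = g x → δ x ≤ u := by
    intro x u hu hux
    -- The left limit is needed because `Q` may have an atom at `g x`.
    have h1 : Function.leftLim (cdf Q) (g x) ≤ u := by
      refine le_of_tendsto ((monotone_cdf Q).tendsto_leftLim (g x)) ?_
      filter_upwards [self_mem_nhdsWithin] with t ht
      refine le_of_not_ge fun h => ?_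
      exact absurd ((hq u hu t).2 h) (not_le.2 (hux ▸ ht))
    rw [← ENNReal.ofReal_le_ofReal_iff hu.1.le]
    calc ENNReal.ofReal (δ x) = 1 - ENNReal.ofReal (1 - δ x) := by
          rw [← ENNReal.ofReal_one, ← ENNReal.ofReal_sub _ (sub_nonneg.2 (hcloud.lower_le_one x)),
            sub_sub_cancel]
      _ ≤ 1 - (P : Measure X) {y | δ x ≤ δ y} :=
        tsub_le_tsub_left (hP _ ⟨hcloud.lower_nonneg x, hcloud.lower_le_one x⟩).1 _
      _ = (P : Measure X) {y | δ x ≤ δ y}ᶜ :=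
        (prob_compl_eq_one_sub (measurableSet_le measurable_const hδ)).symm
      _ ≤ (P : Measure X) {y | g y < g x} := by
        refine measure_mono fun y hy => ?_
        refine lt_of_not_ge (a := g y) (b := g x) fun h => ?_
        exact hy (hcom.le_of_add_le_add h).1
      _ = (cdf Q).measure (Iio (g x)) := by
        rw [measure_cdf, Measure.map_apply hg measurableSet_Iio]; rfl
      _ = ENNReal.ofReal (Function.leftLim (cdf Q) (g x)) := by
        rw [(cdf Q).measure_Iio (tendsto_cdf_atBot Q), sub_zero]
      _ ≤ ENNReal.ofReal u := ENNReal.ofReal_le_ofReal h1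
  calc (P : Measure X) B ≤ (P : Measure X) (g ⁻¹' (g '' B)) :=
        measure_mono (subset_preimage_image _ _)
    _ ≤ Q (g '' B) := Measure.le_map_apply hg.aemeasurable _
    _ = volume.restrict (Ioo (0 : ℝ) 1) (q ⁻¹' (g '' B)) := by
      -- The image `g '' B` is only analytic, hence the null-measurable form of the pushforward
      -- formula.
      rw [← hqQ] at hgB
      rw [← Measure.map_apply₀ hqm hgB, hqQ]
    _ = volume (q ⁻¹' (g '' B) ∩ Ioo (0 : ℝ) 1) := Measure.restrict_apply' measurableSet_Ioo
    _ ≤ _ := by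
      refine measure_mono ?_
      rintro u ⟨⟨x, hxB, hx⟩, hu⟩
      exact ⟨Ioo_subset_Icc_self hu, x, ⟨hupper x u hu hx.symm, hlower x u hu hx.symm⟩, hxB⟩

/-! ### Measurability of level sets and the two inclusions -/

theorem nullMeasurableSet_closedFocalSet_inter_nonempty {X : Type*} [MeasurableSpace X]
    [StandardBorelSpace X] {δ π : X → ℝ} (hδ : Measurable δ) (hπ : Measurable π) {B : Set X}
    (hB : MeasurableSet B) :
    NullMeasurableSet {α | α ∈ Icc (0 : ℝ) 1 ∧ (closedFocalSet δ π α ∩ B).Nonempty} volume := by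
  have hW : AnalyticSet {α : ℝ | (closedFocalSet δ π α ∩ B).Nonempty} := by
    have hS : MeasurableSet {p : X × ℝ | (p.2 ≤ π p.1 ∧ δ p.1 ≤ p.2) ∧ p.1 ∈ B} :=
      ((measurableSet_le measurable_snd (hπ.comp measurable_fst)).inter
        (measurableSet_le (hδ.comp measurable_fst) measurable_snd)).inter (measurable_fst hB)
    convert hS.analyticSet_image measurable_snd using 1
    ext α
    constructor
    · rintro ⟨x, hx⟩
      exact ⟨(x, α), hx, rfl⟩
    · rintro ⟨⟨x, α⟩, hx, rfl⟩
      exact ⟨x, hx⟩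
  have h : NullMeasurableSet {α : ℝ | (closedFocalSet δ π α ∩ B).Nonempty}
    (volume.restrict (Icc (0 : ℝ) 1)) := nullMeasurableSet_of_analyticSet hW
  rw [nullMeasurableSet_restrict measurableSet_Icc.nullMeasurableSet, inter_comm] at h
  exact h

theorem setOf_subset_eq_diff {X : Type*} (E : ℝ → Set X) (A : Set X) :
    {α | α ∈ Icc (0 : ℝ) 1 ∧ E α ⊆ A} =
      Icc (0 : ℝ) 1 \ {α | α ∈ Icc (0 : ℝ) 1 ∧ (E α ∩ Aᶜ).Nonempty} := by
  ext α
  simp only [Set.mem_sdiff, mem_ofPred_eq, inter_compl_nonempty_iff]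
  tauto

theorem nullMeasurableSet_closedFocalSet_subset {X : Type*} [MeasurableSpace X]
    [StandardBorelSpace X] {δ π : X → ℝ} (hδ : Measurable δ) (hπ : Measurable π) {A : Set X}
    (hA : MeasurableSet A) :
    NullMeasurableSet {α | α ∈ Icc (0 : ℝ) 1 ∧ closedFocalSet δ π α ⊆ A} volume := by
  rw [setOf_subset_eq_diff]
  exact measurableSet_Icc.nullMeasurableSet.diff
    (nullMeasurableSet_closedFocalSet_inter_nonempty hδ hπ hA.compl)

theorem cloudCredalSet_subset_beliefCredalSet_closedFocalSet {X : Type*} [MeasurableSpace X]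
    [StandardBorelSpace X] {δ π : X → ℝ} (hcloud : IsCloud δ π) (hcom : IsComonotonic δ π)
    (hδ : Measurable δ) (hπ : Measurable π) :
    cloudCredalSet δ π ⊆ beliefCredalSet (closedFocalSet δ π) := by
  intro P hP A hA
  have hle := measure_le_volume_closedFocalSet_inter_nonempty hcloud hcom hδ hπ hP hA.compl
  have hsub : {α | α ∈ Icc (0 : ℝ) 1 ∧ (closedFocalSet δ π α ∩ Aᶜ).Nonempty} ⊆ Icc 0 1 :=
    fun α hα => hα.1
  rw [belief, setOf_subset_eq_diff, measure_sdiff hsub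
    (nullMeasurableSet_closedFocalSet_inter_nonempty hδ hπ hA.compl)
    (measure_ne_top_of_subset hsub (by simp)), Real.volume_Icc, sub_zero, ENNReal.ofReal_one]
  refine (tsub_le_tsub_left hle 1).trans ?_
  rw [← prob_compl_eq_one_sub hA.compl, compl_compl]

/-- The constraints of the cloud are the belief constraints for the events `δ < α` and `π > α`. -/
theorem beliefCredalSet_subset_cloudCredalSet {X : Type*} [MeasurableSpace X] {δ π : X → ℝ}
    (hδ : Measurable δ) (hπ : Measurable π) {E : ℝ → Set X}
    (hE : ∀ α, E α ⊆ closedFocalSet δ π α) :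
    beliefCredalSet E ⊆ cloudCredalSet δ π := by
  intro P hP α hα
  constructor
  · have hm : MeasurableSet {x | α ≤ δ x} := measurableSet_le measurable_const hδ
    have h : ENNReal.ofReal α ≤ (P : Measure X) {x | α ≤ δ x}ᶜ := by
      refine le_trans ?_ (hP _ hm.compl)
      calc ENNReal.ofReal α = volume (Ico 0 α) := by simp
        _ ≤ belief E {x | α ≤ δ x}ᶜ := measure_mono fun β hβ => ⟨⟨hβ.1, hβ.2.le.trans hα.2⟩,
          fun x hx => not_le.2 ((hE β hx).2.trans_lt hβ.2)⟩
    calc (P : Measure X) {x | α ≤ δ x} = 1 - (P : Measure X) {x | α ≤ δ x}ᶜ := by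
          rw [← prob_compl_eq_one_sub hm.compl, compl_compl]
      _ ≤ 1 - ENNReal.ofReal α := tsub_le_tsub_left h 1
      _ = ENNReal.ofReal (1 - α) := by
        rw [← ENNReal.ofReal_one, ENNReal.ofReal_sub _ hα.1]
  · refine le_trans ?_ (hP _ (measurableSet_lt measurable_const hπ))
    calc ENNReal.ofReal (1 - α) = volume (Ioc α 1) := by simp
      _ ≤ belief E {x | α < π x} := measure_mono fun β hβ => ⟨⟨hα.1.trans hβ.1.le, hβ.2⟩,
        fun x hx => hβ.1.trans_le (hE β hx).1⟩

/-- By connectedness: the closed sets `{α ≤ π}` and `{δ ≤ α}` are nonempty and cover the space, so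
they meet. -/
theorem closedFocalSet_nonempty {X : Type*} [TopologicalSpace X] [PreconnectedSpace X]
    {δ π : X → ℝ} (hcloud : IsCloud δ π) (hδ : Continuous δ) (hπ : Continuous π) {α : ℝ}
    (hα : α ∈ Icc (0 : ℝ) 1) : (closedFocalSet δ π α).Nonempty := by
  obtain ⟨x, hx⟩ := hcloud.exists_upper_eq_one
  obtain ⟨y, hy⟩ := hcloud.exists_lower_eq_zero
  have h := isPreconnected_closed_iff.1 (isPreconnected_univ (α := X)) {x | α ≤ π x} {x | δ x ≤ α}
    (isClosed_le continuous_const hπ) (isClosed_le hδ continuous_const)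
    (fun z _ => (le_total α (δ z)).imp (fun h => h.trans (hcloud.lower_le_upper z)) id)
    ⟨x, mem_univ x, hα.2.trans hx.ge⟩ ⟨y, mem_univ y, hy.le.trans hα.1⟩
  rwa [univ_inter] at h

theorem focalSet_subset_closedFocalSet {X : Type*} (δ π : X → ℝ) (α : ℝ) :
    focalSet δ π α ⊆ closedFocalSet δ π α := fun _ hx => ⟨hx.1, hx.2.le⟩

/-! ### Passing from closed focal sets to `focalSet` -/

/-- The levels which are left endpoints of gaps of `T` are countable. -/
theorem countable_setOf_inter_Ioc_eq_empty (T : Set ℝ) :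
    {α | α ∈ T ∧ ∃ β > α, T ∩ Ioc α β = ∅}.Countable := by
  have hex : ∀ α ∈ {α | α ∈ T ∧ ∃ β > α, T ∩ Ioc α β = ∅}, ∃ β > α, T ∩ Ioc α β = ∅ :=
    fun α hα => hα.2
  choose! b hb hTb using hex
  refine PairwiseDisjoint.countable_of_Ioo (y := b) ?_ hb
  intro α hα β hβ hne
  wlog hlt : α < β generalizing α β with H
  · exact (H hβ hα hne.symm (lt_of_le_of_ne (not_lt.1 hlt) hne.symm)).symm
  refine Set.disjoint_left.2 fun t ht ht' => ?_
  have hmem : β ∈ T ∩ Ioc α (b α) := ⟨hβ.1, hlt, ht'.1.le.trans ht.2.le⟩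
  rw [hTb α hα] at hmem
  exact hmem

/-- The levels of thin points above a nondegenerate focal interval with the same upper value are
countable. -/
theorem IsComonotonic.countable_setOf_thin {X : Type*} {δ π : X → ℝ} (hcom : IsComonotonic δ π) :
    {α | (∃ x, δ x = α ∧ π x = α) ∧ (focalSet δ π α).Nonempty}.Countable := by
  have hex : ∀ α ∈ {α | (∃ x, δ x = α ∧ π x = α) ∧ (focalSet δ π α).Nonempty},
      ∃ y, π y = α ∧ δ y < α := by
    rintro α ⟨⟨x, hδx, hπx⟩, y, hy⟩
    refine ⟨y, le_antisymm ?_ hy.1, hy.2⟩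
    exact hπx ▸ hcom y x (hδx.symm ▸ hy.2)
  rcases isEmpty_or_nonempty X with hX | hX
  · refine countable_empty.mono ?_
    rintro α ⟨⟨x, -⟩, -⟩
    exact isEmptyElim x
  choose! y hyπ hyδ using hex
  -- For `α < β`, an overlap would give `δ (y β) < α = δ x` with `π x = α`, so comonotonicity would
  -- force `β ≤ α`.
  refine PairwiseDisjoint.countable_of_isOpen (s := fun α => Ioo (δ (y α)) α) ?_
    (fun _ _ => isOpen_Ioo) (fun α hα => nonempty_Ioo.2 (hyδ α hα))
  intro α hα β hβ hne
  wlog hlt : α < β generalizing α β with H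
  · exact (H hβ hα hne.symm (lt_of_le_of_ne (not_lt.1 hlt) hne.symm)).symm
  refine Set.disjoint_left.2 fun t ht ht' => ?_
  obtain ⟨⟨x, hδx, hπx⟩, -⟩ := hα
  have h := hcom (y β) x (hδx.symm ▸ ht'.1.trans ht.2)
  rw [hyπ β hβ, hπx] at h
  exact absurd h (not_le.2 hlt)

/-- When almost no focal set `{π ≥ α, δ < α}` is empty, almost every one that is contained in `A`
has its closed counterpart in `A`. -/
theorem IsComonotonic.ae_eq_focalSet_subset {X : Type*} {δ π : X → ℝ} (hcom : IsComonotonic δ π)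
    (hempty : volume {α | α ∈ Icc (0 : ℝ) 1 ∧ focalSet δ π α = ∅} = 0) (A : Set X) :
    ({α | α ∈ Icc (0 : ℝ) 1 ∧ closedFocalSet δ π α ⊆ A} : Set ℝ) =ᵐ[volume]
      ({α | α ∈ Icc (0 : ℝ) 1 ∧ focalSet δ π α ⊆ A} : Set ℝ) := by
  set T : Set ℝ := {α | α ∈ Icc (0 : ℝ) 1 ∧ focalSet δ π α ⊆ A} with hT
  have hsub : {α | α ∈ Icc (0 : ℝ) 1 ∧ closedFocalSet δ π α ⊆ A} ⊆ T :=
    fun α hα => ⟨hα.1, (focalSet_subset_closedFocalSet δ π α).trans hα.2⟩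
  refine (LE.le.eventuallyLE hsub).antisymm (ae_le_set.2 ?_)
  have hnull := measure_union_null (measure_union_null hempty
    ((countable_setOf_inter_Ioc_eq_empty T).measure_zero volume))
    (hcom.countable_setOf_thin.measure_zero volume)
  refine measure_mono_null ?_ hnull
  rintro α ⟨hαT, hα⟩
  have hnot : ¬ closedFocalSet δ π α ⊆ A := fun h => hα ⟨hαT.1, h⟩
  obtain ⟨x, hx, hxA⟩ := Set.not_subset.1 hnot
  have hδx : δ x = α := le_antisymm hx.2 (not_lt.1 fun h => hxA (hαT.2 ⟨hx.1, h⟩))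
  rcases (focalSet δ π α).eq_empty_or_nonempty with he | hne
  · exact Or.inl (Or.inl ⟨hαT.1, he⟩)
  rcases hx.1.eq_or_lt with hπx | hπx
  -- A point `x ∉ A` with `δ x = α` is either thin, or lies in `focalSet δ π β` for every `β ∈ (α, π
  -- x]`, making `α` the left end of a gap of `T`.
  · exact Or.inr ⟨⟨x, hδx, hπx.symm⟩, hne⟩
  · refine Or.inl (Or.inr ⟨hαT, π x, hπx, ?_⟩)
    refine eq_empty_of_forall_notMem fun β hβ => hxA (hβ.1.2 ⟨hβ.2.2, ?_⟩)
    exact hδx.trans_lt hβ.2.1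

end Clouds

theorem mainTheorem7 (I : Set ℝ) (hI : I.OrdConnected) (δ π : I → ℝ)
    (hcloud : Clouds.IsCloud δ π) (hcom : Clouds.IsComonotonic δ π)
    (hδ : Continuous δ) (hπ : Continuous π) :
    (volume {α | α ∈ Set.Icc (0 : ℝ) 1 ∧ Clouds.focalSet δ π α = ∅} = 0 →
      Clouds.IsRandomSet (Clouds.focalSet δ π) ∧
      Clouds.cloudCredalSet δ π = Clouds.beliefCredalSet (Clouds.focalSet δ π)) ∧
    (Clouds.IsRandomSet (Clouds.closedFocalSet δ π) ∧
      Clouds.cloudCredalSet δ π = Clouds.beliefCredalSet (Clouds.closedFocalSet δ π)) := by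
  have : StandardBorelSpace I := hI.measurableSet.standardBorel
  have : PreconnectedSpace I := Subtype.preconnectedSpace hI.isPreconnected
  have hnull := fun A (hA : MeasurableSet A) =>
    Clouds.nullMeasurableSet_closedFocalSet_subset hδ.measurable hπ.measurable hA
  have hle := Clouds.cloudCredalSet_subset_beliefCredalSet_closedFocalSet hcloud hcom
    hδ.measurable hπ.measurable
  refine ⟨fun hempty => ⟨⟨fun A hA => ?_, hempty⟩, ?_⟩, ⟨hnull, ?_⟩, ?_⟩
  · exact (hnull A hA).congr (hcom.ae_eq_focalSet_subset hempty A)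
  · refine Subset.antisymm (fun P hP A hA => ?_)
      (Clouds.beliefCredalSet_subset_cloudCredalSet hδ.measurable hπ.measurable
        (Clouds.focalSet_subset_closedFocalSet δ π))
    rw [Clouds.belief, ← measure_congr (hcom.ae_eq_focalSet_subset hempty A)]
    exact hle hP A hA
  · convert measure_empty (μ := (volume : Measure ℝ)) using 2
    exact eq_empty_of_forall_notMem fun α hα =>
      (Clouds.closedFocalSet_nonempty hcloud hδ hπ hα.1).ne_empty hα.2
  · exact Subset.antisymm hle
      (Clouds.beliefCredalSet_subset_cloudCredalSet hδ.measurable hπ.measurable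
        fun _ => Subset.rfl)
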